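/- For a finite undirected graph $G=(V,E)$, possibly with loops and multiple edges, let $Z_G(q,v)=\sum_{E'\subseteq E} q^{k(E')}v^{|E'|}$ ($q,v\in\mathbb{C}$) be its dichromatic polynomial, where $k(E')$ is the number of connected components (including isolated vertices) of $(V,E')$. For integers $s,p\ge 1$ let $\Theta^{(s,p)}$ be the generalized theta graph, obtained by connecting two endvertices in parallel by $p$ internally disjoint chains, each consisting of $s$ edges in series. **Theorem 1.2.** Fix complex numbers $q_0,v_0$ satisfying $|v_0|\le|q_0+v_0|$. Then, for each $\epsilon>0$, there exist $s_0\in\mathbb{N}$ and a map $p_0\colon \mathbb{N}\cap[s_0,\infty)\to\mathbb{N}$ such that for all $s\ge s_0$ and $p\ge p_0(s)$: (a) If $v_0\neq 0$, then $Z_{\Theta^{(s,p)}}(\,\cdot\,,v_0)$ has a zero in the disc $|q-q_0|<\epsilon$. (b) If $q_0\neq 1$, then $Z_{\Theta^{(s,p)}}(q_0,\,\cdot\,)$ has a zero in the disc $|v-v_0|<\epsilon$. -/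

import Mathlib

open scoped Graph

noncomputable section

/-- The set of connected components of a multigraph (isolated vertices included): the quotient of
the vertex set by the equivalence relation generated by adjacency. -/
def Graph.Component {α β : Type*} (G : Graph α β) : Type _ :=
  Quot fun x y : V(G) => G.Adj x y

/-- The number of connected components of a (finite) multigraph. -/
def Graph.numComponents {α β : Type*} (G : Graph α β) : ℕ :=
  Nat.card G.Component

/-- The Potts-model partition function in the Fortuin-Kasteleyn representation,
`Z_G(q, {v_e}) = ∑_{F ⊆ E} q ^ k(F) * ∏_{e ∈ F} v_e`, where `k(F)` is the number of connected
components of the spanning subgraph `(V, F)`. -/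
def Graph.pottsZ {α β : Type*} (G : Graph α β) [Fintype E(G)] (q : ℂ) (v : β → ℂ) : ℂ :=
  ∑ F ∈ E(G).toFinset.powerset, q ^ (G.restrict (F : Set β)).numComponents * ∏ e ∈ F, v e

/-- The dichromatic polynomial `Z_G(q, v)`: all the edge weights are equal to `v`. -/
def Graph.dichromatic {α β : Type*} (G : Graph α β) [Fintype E(G)] (q v : ℂ) : ℂ :=
  G.pottsZ q fun _ => v

/-- The vertices of the generalized theta graph `Θ^(s,p)`: two endvertices, and `s - 1` inner
vertices on each of `p` chains. -/
inductive ThetaVertex (s p : ℕ) : Type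
  | left : ThetaVertex s p
  | right : ThetaVertex s p
  | inner (i : Fin p) (k : Fin (s - 1)) : ThetaVertex s p

/-- The `k`-th vertex along the `i`-th chain of `Θ^(s,p)`, which runs from the endvertex `left`
(at `k = 0`) through the inner vertices of the chain to the endvertex `right` (at `k = s`). -/
def thetaPoint {s p : ℕ} (i : Fin p) (k : ℕ) : ThetaVertex s p :=
  if k = 0 then .left else if h : k - 1 < s - 1 then .inner i ⟨k - 1, h⟩ else .right

/-- The generalized theta graph `Θ^(s,p)` (for `s, p ≥ 1`): `p` chains in parallel, each made of
`s` edges in series. The edge `(i, j)` is the `j`-th edge of the `i`-th chain, counted from `0`.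
For `s = 1` it has `p` parallel edges. -/
def thetaGraph (s p : ℕ) : Graph (ThetaVertex s p) (Fin p × Fin s) where
  vertexSet := Set.univ
  edgeSet := Set.univ
  IsLink e a b := s(a, b) = s(thetaPoint e.1 e.2, thetaPoint e.1 (e.2 + 1))
  isLink_symm _ _ := ⟨fun _ _ h => Sym2.eq_swap.trans h⟩
  eq_or_eq_of_isLink_of_isLink _ x y v w h h' := by
    have h2 : s(x, y) = s(v, w) := h.trans h'.symm
    rcases Sym2.eq_iff.1 h2 with h3 | h3
    · exact Or.inl h3.1
    · exact Or.inr h3.1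
  edge_mem_iff_exists_isLink e := ⟨fun _ => ⟨_, _, rfl⟩, fun _ => trivial⟩
  left_mem_of_isLink _ _ _ _ := trivial

instance (s p : ℕ) : Fintype E(thetaGraph s p) :=
  inferInstanceAs (Fintype (Set.univ : Set (Fin p × Fin s)))

end

/-! Put t = (q+v)/v. Colour counting gives a closed form for the dichromatic polynomial, reducing
its vanishing to g(t)^p = 1 - q with g(t) = 1 + q/(t^s - 1). At fixed v or fixed q, q is an affine
function A + B t, so both claims concern one equation in t, and the hypothesis says |t| ≥ 1. After
an arbitrarily small push to |t| > 1 with q ≠ 0, 1, two equimodularity arguments are stacked. For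
large s, the phase of t^s turns so fast that some nearby t₁ has |g(t₁)| = 1; for large p, g^p turns
so fast near t₁ that it takes the value 1 - q. Both are instances of `eventually_exists_pow_eq`,
which takes logarithms and solves n f(z) = O(1) near a zero of f by a quantitative open mapping
theorem. -/

/-! ### Closed form by counting colourings -/

/-- A natural number `n` to the number of components of a finite multigraph counts the colourings
of the vertices with `n` colours which are constant along edges. -/
theorem Graph.pow_numComponents {α β : Type*} (G : Graph α β) [Finite V(G)] (n : ℕ) :
    n ^ G.numComponents =
      Nat.card {σ : V(G) → Fin n // ∀ x y : V(G), G.Adj x y → σ x = σ y} := by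
  have hfin : Finite G.Component := Quot.finite _
  have h1 : Nat.card (G.Component → Fin n) = n ^ G.numComponents := by
    rw [Nat.card_fun, Nat.card_fin, Graph.numComponents]
  rw [← h1]
  refine Nat.card_congr ⟨fun f => ⟨fun x => f (Quot.mk _ x), fun x y h => ?_⟩,
    fun σ => Quot.lift σ.1 σ.2, fun f => ?_, fun σ => rfl⟩
  · exact congrArg f (Quot.sound h)
  · funext x
    induction x using Quot.ind
    rfl

/-- The vertices of the generalized theta graph are finitely many. -/
instance ThetaVertex.finite (s p : ℕ) : Finite (ThetaVertex s p) :=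
  Finite.of_surjective
    (fun x : Option (Option (Fin p × Fin (s - 1))) => match x with
      | none => ThetaVertex.left
      | some none => ThetaVertex.right
      | some (some ik) => ThetaVertex.inner ik.1 ik.2)
    (fun y => match y with
      | .left => ⟨none, rfl⟩
      | .right => ⟨some none, rfl⟩
      | .inner i k => ⟨some (some (i, k)), rfl⟩)

/-- The colouring of a theta graph with given colours of the ends and of the inner vertices. -/
def thetaColoring {C : Type*} {m p : ℕ} (x : (C × C) × (Fin p → Fin m → C)) :
    ThetaVertex (m + 1) p → C
  | .left => x.1.1
  | .right => x.1.2
  | .inner i k => x.2 i k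

/-- The colours met along a chain with end colours `a`, `b` and inner colours `y`. -/
def chainColors {C : Type*} {m : ℕ} (a b : C) (y : Fin m → C) : Fin (m + 2) → C :=
  Fin.cons (α := fun _ => C) a (Fin.snoc (α := fun _ => C) y b)

theorem thetaColoring_thetaPoint {C : Type*} {m p : ℕ} (x : (C × C) × (Fin p → Fin m → C))
    (i : Fin p) (k : Fin (m + 2)) :
    thetaColoring x (thetaPoint i k) = chainColors x.1.1 x.1.2 (x.2 i) k := by
  refine Fin.cases ?_ (fun k => ?_) k
  · simp [thetaPoint, thetaColoring, chainColors]
  · refine Fin.lastCases ?_ (fun k => ?_) k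
    · simp [thetaPoint, thetaColoring, chainColors]
    · simp [thetaPoint, thetaColoring, chainColors]

theorem thetaColoring_bijective (C : Type*) (m p : ℕ) :
    Function.Bijective
      (thetaColoring : (C × C) × (Fin p → Fin m → C) → ThetaVertex (m + 1) p → C) := by
  refine Function.bijective_iff_has_inverse.2
    ⟨fun σ => ((σ .left, σ .right), fun i k => σ (.inner i k)), fun x => rfl, fun σ => ?_⟩
  funext y
  cases y <;> rfl

-- With indicators as edge factors, the sum over F becomes the expansion of a product over all
-- edges.
open Classical in
theorem pow_numComponents_thetaGraph_restrict (n m p : ℕ) (F : Finset (Fin p × Fin (m + 1))) :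
    (n : ℂ) ^ ((thetaGraph (m + 1) p).restrict (F : Set (Fin p × Fin (m + 1)))).numComponents =
      ∑ x : (Fin n × Fin n) × (Fin p → Fin m → Fin n), ∏ e ∈ F,
        if chainColors x.1.1 x.1.2 (x.2 e.1) e.2.castSucc =
          chainColors x.1.1 x.1.2 (x.2 e.1) e.2.succ then (1 : ℂ) else 0 := by
  have hfin : Finite V((thetaGraph (m + 1) p).restrict (F : Set (Fin p × Fin (m + 1)))) :=
    Subtype.finite
  have hcol : ∀ (x : (Fin n × Fin n) × (Fin p → Fin m → Fin n)) (e : Fin p × Fin (m + 1)),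
      (chainColors x.1.1 x.1.2 (x.2 e.1) e.2.castSucc =
        chainColors x.1.1 x.1.2 (x.2 e.1) e.2.succ) ↔
      thetaColoring x (thetaPoint e.1 e.2) = thetaColoring x (thetaPoint e.1 (e.2 + 1)) := by
    intro x e
    rw [← thetaColoring_thetaPoint, ← thetaColoring_thetaPoint]
    simp
  have hcard : Nat.card {σ : V((thetaGraph (m + 1) p).restrict
        (F : Set (Fin p × Fin (m + 1)))) → Fin n //
        ∀ x y : V((thetaGraph (m + 1) p).restrict (F : Set (Fin p × Fin (m + 1)))),
          ((thetaGraph (m + 1) p).restrict (F : Set (Fin p × Fin (m + 1)))).Adj x y →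
          σ x = σ y} =
      Nat.card {x : (Fin n × Fin n) × (Fin p → Fin m → Fin n) //
        ∀ e ∈ F, chainColors x.1.1 x.1.2 (x.2 e.1) e.2.castSucc =
          chainColors x.1.1 x.1.2 (x.2 e.1) e.2.succ} := by
    symm
    refine Nat.card_congr (Equiv.subtypeEquiv ((Equiv.ofBijective _
      (thetaColoring_bijective (Fin n) m p)).trans
      (Equiv.arrowCongr (Equiv.Set.univ _).symm (Equiv.refl _))) fun x => ?_)
    simp only [hcol]
    constructor
    · rintro h ⟨a, ha⟩ ⟨b, hb⟩ ⟨e, he, hl⟩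
      have hl : s(a, b) = s(thetaPoint e.1 e.2, thetaPoint e.1 (e.2 + 1)) := hl
      have := h e he
      rcases Sym2.eq_iff.1 hl with ⟨rfl, rfl⟩ | ⟨rfl, rfl⟩
      · exact this
      · exact this.symm
    · intro h e he
      exact h ⟨thetaPoint e.1 e.2, trivial⟩ ⟨thetaPoint e.1 (e.2 + 1), trivial⟩ ⟨e, he, rfl⟩
  rw [← Nat.cast_pow, Graph.pow_numComponents, hcard, Nat.card_eq_fintype_card,
    Fintype.card_subtype, Finset.card_filter, Nat.cast_sum]
  refine Finset.sum_congr rfl fun x _ => ?_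
  rw [Finset.prod_ite_zero]
  simp

/-- The transfer-matrix sum along a chain of `m + 1` edges with end colours `a` and `b`. -/
theorem sum_chainColors_prod (n : ℕ) (v : ℂ) (m : ℕ) (a b : Fin n) :
    (n : ℂ) * ∑ y : Fin m → Fin n, ∏ j : Fin (m + 1),
        (1 + if chainColors a b y j.castSucc = chainColors a b y j.succ then v else 0) =
      (n + v) ^ (m + 1) - v ^ (m + 1) + if a = b then n * v ^ (m + 1) else 0 := by
  -- The transfer matrix is J + vI, J all ones, with J² = nJ; the factor n clears the denominator in
  -- its powers.
  induction m generalizing a with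
  | zero =>
    simp [chainColors, Fin.snoc]
    split_ifs <;> ring
  | succ m ih =>
    have hstep : ∀ (c : Fin n) (y : Fin m → Fin n),
        (∏ j : Fin (m + 1 + 1), (1 + if chainColors a b (Fin.cons c y) j.castSucc =
          chainColors a b (Fin.cons c y) j.succ then v else 0)) =
        (1 + if a = c then v else 0) * ∏ j : Fin (m + 1),
          (1 + if chainColors c b y j.castSucc = chainColors c b y j.succ then v else 0) := by
      intro c y
      have hc : chainColors a b (Fin.cons c y : Fin (m + 1) → Fin n) =
          Fin.cons (α := fun _ => Fin n) a (chainColors c b y) := by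
        rw [chainColors, chainColors]
        congr 1
        exact (Fin.cons_snoc_eq_snoc_cons (β := Fin n) c y b).symm
      rw [Fin.prod_univ_succ, hc]
      congr 1
    have hsum : ∀ φ : (Fin (m + 1) → Fin n) → ℂ,
        ∑ y, φ y = ∑ c : Fin n, ∑ y : Fin m → Fin n, φ (Fin.cons c y) := fun φ => by
      rw [← (Fin.consEquiv fun _ => Fin n).sum_comp, Fintype.sum_prod_type]
      rfl
    rw [hsum]
    simp only [hstep, ← Finset.mul_sum]
    rw [Finset.mul_sum]
    simp only [mul_left_comm (n : ℂ), ih]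
    simp only [add_mul, mul_add, one_mul, Finset.sum_add_distrib, ite_mul, zero_mul,
      Finset.sum_ite_eq, Finset.sum_ite_eq', Finset.mem_univ, if_true, Finset.sum_const,
      Finset.card_univ, Fintype.card_fin, nsmul_eq_mul]
    split_ifs <;> ring

/-- Once the end colours are fixed the p chains are independent; n ordered pairs of end colours
agree and n² - n differ. -/
theorem dichromatic_thetaGraph_natCast (n m p : ℕ) (v : ℂ) :
    (n : ℂ) ^ p * (thetaGraph (m + 1) p).dichromatic n v =
      n * ((n + v) ^ (m + 1) - v ^ (m + 1) + n * v ^ (m + 1)) ^ p +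
        (n ^ 2 - n) * ((n + v) ^ (m + 1) - v ^ (m + 1)) ^ p := by
  have hE : E(thetaGraph (m + 1) p).toFinset = Finset.univ := by
    ext e
    simp only [Set.mem_toFinset, Finset.mem_univ, iff_true]
    trivial
  have h1 : (thetaGraph (m + 1) p).dichromatic n v =
      ∑ x : (Fin n × Fin n) × (Fin p → Fin m → Fin n), ∏ i : Fin p, ∏ j : Fin (m + 1),
        (1 + if chainColors x.1.1 x.1.2 (x.2 i) j.castSucc =
          chainColors x.1.1 x.1.2 (x.2 i) j.succ then v else 0) := by
    rw [Graph.dichromatic, Graph.pottsZ, hE]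
    simp only [pow_numComponents_thetaGraph_restrict, Finset.sum_mul]
    rw [Finset.sum_comm]
    refine Finset.sum_congr rfl fun x _ => ?_
    rw [← Fintype.prod_prod_type' (f := fun (i : Fin p) (j : Fin (m + 1)) =>
      (1 + if chainColors x.1.1 x.1.2 (x.2 i) j.castSucc =
        chainColors x.1.1 x.1.2 (x.2 i) j.succ then v else 0)), Finset.prod_one_add]
    refine Finset.sum_congr rfl fun F _ => ?_
    rw [← Finset.prod_mul_distrib]
    refine Finset.prod_congr rfl fun e _ => ?_
    split_ifs <;> simp
  have h2 : ∀ a b : Fin n, (n : ℂ) ^ p * ∑ y : Fin p → Fin m → Fin n, ∏ i : Fin p,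
      ∏ j : Fin (m + 1), (1 + if chainColors a b (y i) j.castSucc =
        chainColors a b (y i) j.succ then v else 0) =
      ((n + v) ^ (m + 1) - v ^ (m + 1) + if a = b then n * v ^ (m + 1) else 0) ^ p := by
    intro a b
    rw [← sum_chainColors_prod, mul_pow, Finset.sum_pow', Fintype.piFinset_univ]
  have h3 : ∀ (a b : Fin n) (X Y : ℂ), (X + if a = b then Y else 0) ^ p =
      X ^ p + if a = b then (X + Y) ^ p - X ^ p else 0 := by
    intro a b X Y
    split_ifs <;> simp
  rw [h1, Fintype.sum_prod_type, Finset.mul_sum]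
  simp only [h2]
  rw [Fintype.sum_prod_type]
  simp only [h3, Finset.sum_add_distrib, Finset.sum_ite_eq, Finset.mem_univ, if_true,
    Finset.sum_const, Finset.card_univ, Fintype.card_fin, nsmul_eq_mul]
  ring

open Polynomial in
/-- The dichromatic polynomial of the generalized theta graph, in closed form. -/
theorem dichromatic_thetaGraph (s p : ℕ) (hs : 1 ≤ s) (q v : ℂ) :
    q ^ p * (thetaGraph s p).dichromatic q v =
      q * ((q + v) ^ s - v ^ s + q * v ^ s) ^ p +
        (q ^ 2 - q) * ((q + v) ^ s - v ^ s) ^ p := by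
  obtain ⟨m, rfl⟩ := Nat.exists_eq_add_of_le' hs
  let P : ℂ[X] := X ^ p * ∑ F ∈ E(thetaGraph (m + 1) p).toFinset.powerset,
    X ^ ((thetaGraph (m + 1) p).restrict (F : Set (Fin p × Fin (m + 1)))).numComponents *
      ∏ _e ∈ F, C v
  let Q : ℂ[X] := X * ((X + C v) ^ (m + 1) - C v ^ (m + 1) + X * C v ^ (m + 1)) ^ p +
    (X ^ 2 - X) * ((X + C v) ^ (m + 1) - C v ^ (m + 1)) ^ p
  have hP : ∀ z, P.eval z = z ^ p * (thetaGraph (m + 1) p).dichromatic z v := by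
    intro z
    simp [P, Graph.dichromatic, Graph.pottsZ, eval_finsetSum]
  have hQ : ∀ z, Q.eval z = z * ((z + v) ^ (m + 1) - v ^ (m + 1) + z * v ^ (m + 1)) ^ p +
      (z ^ 2 - z) * ((z + v) ^ (m + 1) - v ^ (m + 1)) ^ p := by
    intro z
    simp [Q]
  -- Both sides are polynomials in q that agree at every natural number.
  have hPQ : P = Q := by
    refine Polynomial.eq_of_infinite_eval_eq P Q
      ((Set.infinite_range_of_injective (Nat.cast_injective (R := ℂ))).mono ?_)
    rintro _ ⟨n, rfl⟩
    rw [Set.mem_ofPred_eq, hP, hQ, dichromatic_thetaGraph_natCast]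
  rw [← hP, ← hQ, hPQ]

/-- Needed separately: at q = 0 the factor q^p makes the closed form uninformative. -/
theorem dichromatic_zero_left_thetaGraph (s p : ℕ) (v : ℂ) :
    (thetaGraph s p).dichromatic 0 v = 0 := by
  rw [Graph.dichromatic, Graph.pottsZ]
  refine Finset.sum_eq_zero fun F _ => ?_
  have hfin : Finite V((thetaGraph s p).restrict (F : Set (Fin p × Fin s))) := Subtype.finite
  have hfin' : Finite ((thetaGraph s p).restrict (F : Set (Fin p × Fin s))).Component :=
    Quot.finite _
  have hne : Nonempty ((thetaGraph s p).restrict (F : Set (Fin p × Fin s))).Component :=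
    ⟨Quot.mk _ ⟨ThetaVertex.left, trivial⟩⟩
  have hpos : 0 < ((thetaGraph s p).restrict (F : Set (Fin p × Fin s))).numComponents :=
    Nat.card_pos
  rw [zero_pow hpos.ne', zero_mul]

/-! ### Solving rapidly rotating analytic equations -/

open Filter Topology Metric

/-- A nonconstant analytic function attains, near a zero, the value of any small perturbation:
for large `n`, the equation `n * f z = b n z` with uniformly bounded analytic `b n` has a solution
near a zero `z₀` of `f`. -/
theorem eventually_exists_natCast_mul_eq {f : ℂ → ℂ} {b : ℕ → ℂ → ℂ} {z₀ : ℂ} {M r₀ : ℝ}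
    (hf : AnalyticAt ℂ f z₀) (hf0 : f z₀ = 0) (hf1 : ¬ ∀ᶠ z in 𝓝 z₀, f z = 0) (hr₀ : 0 < r₀)
    (hb : ∀ᶠ n in atTop, DifferentiableOn ℂ (b n) (ball z₀ r₀) ∧ ∀ z ∈ ball z₀ r₀, ‖b n z‖ ≤ M)
    {r : ℝ} (hr : 0 < r) :
    ∀ᶠ n : ℕ in atTop, ∃ z ∈ ball z₀ r, n * f z = b n z := by
  have hne : ∀ᶠ z in 𝓝[≠] z₀, f z ≠ 0 :=
    hf.eventually_eq_zero_or_eventually_ne_zero.resolve_left hf1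
  obtain ⟨r₁, hr₁, hball⟩ : ∃ r₁ > 0, ∀ z ∈ ball z₀ r₁, DifferentiableAt ℂ f z ∧
      (z ≠ z₀ → f z ≠ 0) := by
    have h := (hf.eventually_analyticAt.mono fun z hz => hz.differentiableAt).and
      (eventually_nhdsWithin_iff.1 hne)
    exact Metric.eventually_nhds_iff_ball.1 h
  obtain ⟨ρ, hρ, hρ'⟩ : ∃ ρ > 0, ρ < min r (min r₀ r₁) := exists_between (by positivity)
  have hρr : ρ < r := hρ'.trans_le (min_le_left _ _)
  have hρr₀ : ρ < r₀ := hρ'.trans_le ((min_le_right _ _).trans (min_le_left _ _))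
  have hρr₁ : ρ < r₁ := hρ'.trans_le ((min_le_right _ _).trans (min_le_right _ _))
  have hcont : ContinuousOn f (sphere z₀ ρ) := fun z hz =>
    (hball z (sphere_subset_closedBall.trans (closedBall_subset_ball hρr₁) hz)).1.continuousAt
      |>.continuousWithinAt
  obtain ⟨w, hw, hmin⟩ := (isCompact_sphere z₀ ρ).exists_isMinOn
    (NormedSpace.sphere_nonempty.2 hρ.le) hcont.norm
  have hδ : 0 < ‖f w‖ := norm_pos_iff.2 ((hball w
    (sphere_subset_closedBall.trans (closedBall_subset_ball hρr₁) hw)).2 (ne_of_mem_sphere hw hρ.ne'))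
  set δ := ‖f w‖ with hδdef
  -- Two perturbations below δ/4 leave a variation of δ/2 on the sphere, so the image covers radius
  -- δ/4 about the central value, hence 0.
  have hsmall : ∀ᶠ n : ℕ in atTop, M / n < δ / 4 :=
    (tendsto_const_div_atTop_nhds_zero_nat M).eventually (gt_mem_nhds (by positivity))
  filter_upwards [hb, hsmall, eventually_gt_atTop 0] with n hbn hn hn0
  have hn0' : (n : ℂ) ≠ 0 := Nat.cast_ne_zero.2 hn0.ne'
  have hbd : ∀ z ∈ ball z₀ r₀, ‖b n z / n‖ ≤ M / n := fun z hz => by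
    rw [norm_div, Complex.norm_natCast]
    exact div_le_div_of_nonneg_right (hbn.2 z hz) (Nat.cast_nonneg n)
  have hdiff : DiffContOnCl ℂ (fun z => f z - b n z / n) (ball z₀ ρ) := by
    apply DifferentiableOn.diffContOnCl
    rw [closure_ball z₀ hρ.ne']
    exact DifferentiableOn.sub
      (fun z hz => (hball z (closedBall_subset_ball hρr₁ hz)).1.differentiableWithinAt)
      ((hbn.1.mono (closedBall_subset_ball hρr₀)).div_const _)
  have hz₀ := hbd z₀ (mem_ball_self hr₀)
  have hsph : ∀ z ∈ sphere z₀ ρ, δ / 2 ≤ ‖(f z - b n z / n) - (f z₀ - b n z₀ / n)‖ := by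
    intro z hz
    have h1 : δ ≤ ‖f z‖ := hmin hz
    have h2 := hbd z (sphere_subset_closedBall.trans (closedBall_subset_ball hρr₀) hz)
    have h3 : ‖f z‖ ≤ ‖(f z - b n z / n) - (f z₀ - b n z₀ / n)‖ + ‖b n z / n‖ + ‖b n z₀ / n‖ := by
      have : f z = ((f z - b n z / n) - (f z₀ - b n z₀ / n)) + b n z / n + - (b n z₀ / n) := by
        rw [hf0]; ring
      conv_lhs => rw [this]
      refine (norm_add_le _ _).trans ?_
      rw [norm_neg]
      gcongr
      exact norm_add_le _ _
    linarith
  have hnc : ∃ᶠ z in 𝓝 z₀, f z - b n z / n ≠ f z₀ - b n z₀ / n := by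
    intro hev
    have hev' : ∀ᶠ z in 𝓝 z₀, f z - b n z / n = f z₀ - b n z₀ / n := by
      filter_upwards [hev] with z hz using not_not.1 hz
    have han : AnalyticOnNhd ℂ (fun z => f z - b n z / n) (ball z₀ (min r₀ r₁)) := by
      refine DifferentiableOn.analyticOnNhd (DifferentiableOn.sub
        (fun z hz => (hball z (ball_subset_ball (min_le_right _ _) hz)).1.differentiableWithinAt)
        ((hbn.1.mono (ball_subset_ball (min_le_left _ _))).div_const _)) isOpen_ball
    have heq := han.eqOn_of_preconnected_of_eventuallyEq
      (analyticOnNhd_const (v := f z₀ - b n z₀ / n)) (convex_ball _ _).isPreconnected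
      (mem_ball_self (lt_min hr₀ hr₁)) hev'
    have h4 := heq (closedBall_subset_ball (lt_min hρr₀ hρr₁) (sphere_subset_closedBall hw))
    have h5 := hsph w hw
    simp only at h4
    rw [h4, sub_self, norm_zero] at h5
    linarith
  have hmem : (0 : ℂ) ∈ ball (f z₀ - b n z₀ / n) (δ / 2 / 2) := by
    rw [mem_ball, dist_eq_norm, hf0, zero_sub, zero_sub, neg_neg]
    linarith
  obtain ⟨z, hz, hz0⟩ := hdiff.ball_subset_image_closedBall hρ hsph hnc hmem
  refine ⟨z, closedBall_subset_ball hρr hz, ?_⟩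
  simp only at hz0
  rw [sub_eq_zero.1 hz0, mul_div_cancel₀ _ hn0']

/-- Power version of `eventually_exists_natCast_mul_eq`: near any point `z₀` where a nonconstant
analytic `g` does not vanish, the equation `g z ^ n = ‖g z₀‖ ^ n * a n z` has a solution for all
large `n`, provided that the analytic functions `a n` stay close to a nonzero constant. -/
theorem eventually_exists_pow_eq {g : ℂ → ℂ} {a : ℕ → ℂ → ℂ} {z₀ α : ℂ} {r₀ : ℝ}
    (hg : AnalyticAt ℂ g z₀) (hg0 : g z₀ ≠ 0) (hg1 : ¬ ∀ᶠ z in 𝓝 z₀, g z = g z₀) (hr₀ : 0 < r₀)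
    (hα : α ≠ 0)
    (ha : ∀ᶠ n in atTop, DifferentiableOn ℂ (a n) (ball z₀ r₀) ∧
      ∀ z ∈ ball z₀ r₀, ‖a n z - α‖ ≤ ‖α‖ / 2)
    {r : ℝ} (hr : 0 < r) :
    ∀ᶠ n : ℕ in atTop, ∃ z ∈ ball z₀ r, g z ^ n = (‖g z₀‖ : ℂ) ^ n * a n z := by
  have hg0' : (‖g z₀‖ : ℂ) ≠ 0 := by simpa using hg0
  have hslit : g z₀ / g z₀ ∈ Complex.slitPlane := by
    rw [div_self hg0]; exact Complex.one_mem_slitPlane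
  have hgd : AnalyticAt ℂ (fun z => g z / g z₀) z₀ := hg.div analyticAt_const hg0
  have hgne : ∀ᶠ z in 𝓝 z₀, g z ≠ 0 := hg.continuousAt.eventually_ne hg0
  obtain ⟨r₁, hr₁, hball⟩ := Metric.eventually_nhds_iff_ball.1 hgne
  have hα' : 0 < ‖α‖ := norm_pos_iff.2 hα
  -- The phase of g(z₀)^n is absorbed into a constant of modulus |α|, whose principal logarithm is
  -- bounded uniformly in n.
  set c : ℕ → ℂ := fun n => α * ((‖g z₀‖ : ℂ) / g z₀) ^ n with hc
  have hcne : ∀ n, c n ≠ 0 := fun n => mul_ne_zero hα (pow_ne_zero _ (div_ne_zero hg0' hg0))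
  have hcn : ∀ n, ‖c n‖ = ‖α‖ := fun n => by
    simp [hc, div_self (norm_ne_zero_iff.2 hg0)]
  have key := eventually_exists_natCast_mul_eq (f := fun z => Complex.log (g z / g z₀))
    (b := fun n z => Complex.log (c n) + Complex.log (1 + (a n z - α) / α))
    (M := |Real.log ‖α‖| + Real.pi + 3 / 2 * (1 / 2)) (r₀ := r₀) (hgd.clog hslit)
    (by simp [div_self hg0]) ?_ hr₀ ?_ (lt_min hr (lt_min hr₀ hr₁))
  · filter_upwards [key, ha] with n ⟨z, hz, hzn⟩ han
    rw [mem_ball, lt_min_iff, lt_min_iff] at hz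
    have hgz : g z / g z₀ ≠ 0 := div_ne_zero (hball z hz.2.2) hg0
    have hu : ‖(a n z - α) / α‖ < 1 := by
      rw [norm_div, div_lt_one hα']
      linarith [han.2 z hz.2.1]
    have hexp := congrArg Complex.exp hzn
    rw [Complex.exp_add, Complex.exp_nat_mul, Complex.exp_log hgz, Complex.exp_log (hcne n),
      Complex.exp_log (Complex.slitPlane_ne_zero (Complex.mem_slitPlane_of_norm_lt_one hu))] at hexp
    refine ⟨z, hz.1, ?_⟩
    simp only [hc, div_pow, one_add_div hα, add_sub_cancel] at hexp
    field_simp at hexp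
    linear_combination hexp
  · intro hev
    apply hg1
    filter_upwards [hev, hgne] with z hz hgz
    have h1 := Complex.exp_log (div_ne_zero hgz hg0)
    rw [hz, Complex.exp_zero] at h1
    exact ((div_eq_one_iff_eq hg0).1 h1.symm)
  · filter_upwards [ha] with n han
    have hu : ∀ z ∈ ball z₀ r₀, ‖(a n z - α) / α‖ ≤ 1 / 2 := fun z hz => by
      rw [norm_div, div_le_iff₀ hα']
      linarith [han.2 z hz]
    refine ⟨?_, fun z hz => ?_⟩
    · refine (differentiableOn_const _).add (DifferentiableOn.clog
        ((differentiableOn_const _).add ((han.1.sub_const _).div_const _)) fun z hz => ?_)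
      exact Complex.mem_slitPlane_of_norm_lt_one ((hu z hz).trans_lt (by norm_num))
    · refine (norm_add_le _ _).trans (add_le_add ?_ ?_)
      · refine (Complex.norm_le_abs_re_add_abs_im _).trans ?_
        rw [Complex.log_re, Complex.log_im, hcn]
        gcongr
        exact Complex.abs_arg_le_pi _
      · refine (Complex.norm_log_one_add_half_le_self (hu z hz)).trans ?_
        gcongr
        exact hu z hz

/-! ### Roots in the variable t -/

theorem dichromatic_thetaGraph_eq_zero {s p : ℕ} (hs : 1 ≤ s) {q v t : ℂ} (hq : q ≠ 0)
    (ht : q + v = t * v) (h : (t ^ s - 1 + q) ^ p = (1 - q) * (t ^ s - 1) ^ p) :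
    (thetaGraph s p).dichromatic q v = 0 := by
  have h1 := dichromatic_thetaGraph s p hs q v
  have h2 : (t * v) ^ s - v ^ s + q * v ^ s = v ^ s * (t ^ s - 1 + q) := by ring
  have h3 : (t * v) ^ s - v ^ s = v ^ s * (t ^ s - 1) := by ring
  rw [ht, h2, h3, mul_pow, mul_pow, h] at h1
  refine (mul_eq_zero.1 (h1.trans ?_)).resolve_left (pow_ne_zero p hq)
  ring

/-- Near any `t₀` with `‖t₀‖ > 1`, at which the affine function `A + B * t` avoids `0` and `1`,
one finds for all large `s` a point where `1 + (A + B * t) / (t ^ s - 1)` is unimodular. -/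
theorem eventually_exists_pow_eq_unimodular {A B t₀ : ℂ} (ht₀ : 1 < ‖t₀‖) (hq : A + B * t₀ ≠ 0)
    {r : ℝ} (hr : 0 < r) :
    ∀ᶠ s : ℕ in atTop, ∃ t ∈ ball t₀ r, ∃ y : ℝ,
      t ^ s = 1 + (A + B * t) * (-1 / 2 + Complex.I * y) := by
  have h0 : t₀ ≠ 0 := norm_pos_iff.1 (zero_lt_one.trans ht₀)
  set R : ℂ := (‖t₀‖ : ℂ) with hR
  have hR0 : R ≠ 0 := by simpa [hR] using h0
  -- With y = R^n, the target 1 + q(-1/2 + iy) equals R^n times this, which tends to iq.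
  set a : ℕ → ℂ → ℂ := fun n z =>
    Complex.I * (A + B * z) + (1 - (A + B * z) / 2) * (R⁻¹) ^ n with ha
  have hα : Complex.I * (A + B * t₀) ≠ 0 := mul_ne_zero Complex.I_ne_zero hq
  have hlim : Tendsto (fun x : ℕ × ℂ => a x.1 x.2) (atTop ×ˢ 𝓝 t₀)
      (𝓝 (Complex.I * (A + B * t₀))) := by
    have h1 : Tendsto (fun x : ℕ × ℂ => (R⁻¹) ^ x.1) (atTop ×ˢ 𝓝 t₀) (𝓝 0) :=
      (tendsto_pow_atTop_nhds_zero_of_norm_lt_one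
        (by simpa [hR] using inv_lt_one_of_one_lt₀ ht₀)).comp tendsto_fst
    have h2 : Tendsto (fun x : ℕ × ℂ => A + B * x.2) (atTop ×ˢ 𝓝 t₀) (𝓝 (A + B * t₀)) :=
      (tendsto_snd.const_mul B).const_add A
    have h3 := (h2.const_mul Complex.I).add (((h2.div_const 2).const_sub 1).mul h1)
    rwa [mul_zero, add_zero] at h3
  have hev : ∀ᶠ x : ℕ × ℂ in atTop ×ˢ 𝓝 t₀,
      ‖a x.1 x.2 - Complex.I * (A + B * t₀)‖ ≤ ‖Complex.I * (A + B * t₀)‖ / 2 := by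
    filter_upwards [hlim.eventually (ball_mem_nhds _ (half_pos (norm_pos_iff.2 hα)))] with x hx
    rw [dist_eq_norm] at hx
    exact hx.le
  obtain ⟨pa, hpa, pb, hpb, hab⟩ := eventually_prod_iff.1 hev
  obtain ⟨r₀, hr₀, hball⟩ := Metric.eventually_nhds_iff_ball.1 hpb
  have hid : ¬ ∀ᶠ z in 𝓝 t₀, id z = id t₀ := by
    intro h
    have h1 : {t₀} ∈ 𝓝 t₀ := h
    exact (infinite_of_mem_nhds t₀ h1) (Set.finite_singleton t₀)
  have key := eventually_exists_pow_eq (g := id) (a := a) analyticAt_id h0 hid hr₀ hα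
    (hpa.mono fun n hn => ⟨by fun_prop, fun z hz => hab hn (hball z hz)⟩) hr
  filter_upwards [key] with n ⟨z, hz, hzn⟩
  refine ⟨z, hz, ‖t₀‖ ^ n, ?_⟩
  have hRn : R ^ n * (R⁻¹) ^ n = 1 := by rw [← mul_pow, mul_inv_cancel₀ hR0, one_pow]
  simp only [id, ha] at hzn
  push_cast
  rw [hzn]
  linear_combination (1 - (A + B * z) / 2) * hRn

/-- Ensures that g is not locally constant: for s ≥ 2 the affine side has no term of degree s. -/
theorem not_eventually_affine_eq_pow {A B k t₁ : ℂ} {s : ℕ} (hs : 2 ≤ s) (hk : k ≠ 0) :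
    ¬ ∀ᶠ t in 𝓝 t₁, A + B * t = k * (t ^ s - 1) := by
  intro h
  have hP := Polynomial.eq_of_infinite_eval_eq
    (Polynomial.C A + Polynomial.C B * Polynomial.X)
    (Polynomial.C k * (Polynomial.X ^ s - 1)) ((infinite_of_mem_nhds t₁ h).mono fun t ht => by
      have ht : A + B * t = k * (t ^ s - 1) := ht
      simpa using ht)
  have hc := congrArg (fun P => Polynomial.coeff P s) hP
  have h0 : s ≠ 0 := by omega
  have h1 : 1 ≠ s := by omega
  simp only [Polynomial.coeff_add, Polynomial.coeff_sub, Polynomial.coeff_C_mul,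
    Polynomial.coeff_C, Polynomial.coeff_X, Polynomial.coeff_one, Polynomial.coeff_X_pow,
    if_neg h0, if_neg h1, if_true] at hc
  exact hk (by linear_combination -hc)

theorem eventually_eventually_exists_root {A B t₀ : ℂ} (ht₀ : 1 < ‖t₀‖) (hq0 : A + B * t₀ ≠ 0)
    (hq1 : A + B * t₀ ≠ 1) {U : Set ℂ} (hU : U ∈ 𝓝 t₀) :
    ∀ᶠ s : ℕ in atTop, ∀ᶠ p : ℕ in atTop, ∃ t ∈ U, A + B * t ≠ 0 ∧
      (t ^ s - 1 + (A + B * t)) ^ p = (1 - (A + B * t)) * (t ^ s - 1) ^ p := by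
  have hcont : Continuous fun t : ℂ => A + B * t := by fun_prop
  have hgood : ∀ᶠ t in 𝓝 t₀, t ∈ U ∧ 1 < ‖t‖ ∧ A + B * t ≠ 0 ∧ A + B * t ≠ 1 :=
    Filter.Eventually.and hU ((continuous_norm.continuousAt.eventually (lt_mem_nhds ht₀)).and
      ((hcont.continuousAt.eventually_ne hq0).and (hcont.continuousAt.eventually_ne hq1)))
  obtain ⟨r, hr, hball⟩ := Metric.eventually_nhds_iff_ball.1 hgood
  filter_upwards [eventually_exists_pow_eq_unimodular ht₀ hq0 hr, eventually_ge_atTop 2]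
    with s ⟨t₁, ht₁, y, hy⟩ hs
  have hpow : ∀ t ∈ ball t₀ r, t ^ s - 1 ≠ 0 := fun t ht h => by
    have h1 : 1 < ‖t‖ ^ s := one_lt_pow₀ (hball t ht).2.1 (by omega)
    rw [← norm_pow, sub_eq_zero.1 h, norm_one] at h1
    exact lt_irrefl _ h1
  obtain ⟨-, -, hq0', hq1'⟩ := hball t₁ ht₁
  have hp1 := hpow t₁ ht₁
  set g : ℂ → ℂ := fun t => 1 + (A + B * t) / (t ^ s - 1) with hg
  have hw : (-1 / 2 + Complex.I * y : ℂ) ≠ 0 := fun h => by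
    rw [h, mul_zero, add_zero] at hy
    exact hp1 (by rw [hy, sub_self])
  have hg1 : ‖g t₁‖ = 1 := by
    -- For Re w = -1/2, w + 1 is the reflection of w in the imaginary axis, so |1 + 1/w| = 1; here
    -- g(t₁) = 1 + 1/w.
    have hconj : -(starRingEnd ℂ (-1 / 2 + Complex.I * y)) = (-1 / 2 + Complex.I * y) + 1 := by
      simp only [map_add, map_mul, map_div₀, map_neg, map_one, Complex.conj_I, Complex.conj_ofReal,
        map_ofNat]
      ring
    have h1 : g t₁ = -(starRingEnd ℂ (-1 / 2 + Complex.I * y)) / (-1 / 2 + Complex.I * y) := by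
      have h2 : t₁ ^ s - 1 = (A + B * t₁) * (-1 / 2 + Complex.I * y) := by rw [hy]; ring
      rw [hconj, add_div, div_self hw, hg]
      simp only [h2]
      rw [div_mul_cancel_left₀ hq0', one_div]
    rw [h1, norm_div, norm_neg, Complex.norm_conj, div_self (norm_ne_zero_iff.2 hw)]
  have hgan : AnalyticAt ℂ g t₁ := by
    refine analyticAt_const.add (AnalyticAt.div ?_ ?_ hp1) <;> fun_prop
  have hgc : ¬ ∀ᶠ z in 𝓝 t₁, g z = g t₁ := by
    intro h
    refine not_eventually_affine_eq_pow (A := A) (B := B) (t₁ := t₁) hs (div_ne_zero hq0' hp1) ?_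
    filter_upwards [h, isOpen_ball.mem_nhds ht₁] with t ht htb
    have h1 := add_left_cancel ht
    rwa [div_eq_iff (hpow t htb)] at h1
  have hα : 1 - (A + B * t₁) ≠ 0 := sub_ne_zero.2 hq1'.symm
  have hnear : ∀ᶠ z in 𝓝 t₁,
      ‖(1 - (A + B * z)) - (1 - (A + B * t₁))‖ ≤ ‖1 - (A + B * t₁)‖ / 2 := by
    have hc : Continuous fun z : ℂ => 1 - (A + B * z) := by fun_prop
    filter_upwards [hc.continuousAt (ball_mem_nhds _ (half_pos (norm_pos_iff.2 hα)))] with x hx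
    have hx : 1 - (A + B * x) ∈ ball (1 - (A + B * t₁)) (‖1 - (A + B * t₁)‖ / 2) := hx
    rw [mem_ball, dist_eq_norm] at hx
    exact hx.le
  obtain ⟨r₀, hr₀, hball₀⟩ := Metric.eventually_nhds_iff_ball.1 hnear
  obtain ⟨r₁, hr₁, hball₁⟩ := Metric.isOpen_iff.1 isOpen_ball t₁ ht₁
  have key := eventually_exists_pow_eq (a := fun _ z => 1 - (A + B * z)) hgan
    (norm_ne_zero_iff.1 (by rw [hg1]; exact one_ne_zero)) hgc hr₀ hα
    (Eventually.of_forall fun n => ⟨by fun_prop, hball₀⟩) hr₁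
  filter_upwards [key] with p ⟨t, ht, htp⟩
  have htb := hball₁ ht
  refine ⟨t, (hball t htb).1, (hball t htb).2.2.1, ?_⟩
  have hp := hpow t htb
  rw [hg1, Complex.ofReal_one, one_pow, one_mul, hg] at htp
  simp only [one_add_div hp, div_pow] at htp
  exact (div_eq_iff (pow_ne_zero p hp)).1 htp

/-! ### Returning to q and v -/

/-- Scaling t radially outward makes the norm exceed 1, and only one scale gives it the norm of w.
-/
theorem exists_mem_one_lt_norm_ne {t : ℂ} (ht : 1 ≤ ‖t‖) {U : Set ℂ} (hU : U ∈ 𝓝 t) (w : ℂ) :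
    ∃ t' ∈ U, 1 < ‖t'‖ ∧ t' ≠ w := by
  have ht0 : 0 < ‖t‖ := zero_lt_one.trans_le ht
  have hlim : Tendsto (fun x : ℝ => (x : ℂ) * t) (𝓝[>] 1) (𝓝 t) := by
    have hc : Continuous fun x : ℝ => (x : ℂ) * t := by fun_prop
    simpa using (hc.tendsto 1).mono_left nhdsWithin_le_nhds
  have hne : ∀ᶠ x : ℝ in 𝓝[>] 1, x ≠ ‖w‖ / ‖t‖ := by
    rcases eq_or_ne (1 : ℝ) (‖w‖ / ‖t‖) with h | h
    · rw [← h]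
      filter_upwards [self_mem_nhdsWithin] with x hx using ne_of_gt hx
    · exact (eventually_ne_nhds h).filter_mono nhdsWithin_le_nhds
  obtain ⟨x, hxU, hx1, hxw⟩ :=
    ((hlim.eventually hU).and (Filter.Eventually.and self_mem_nhdsWithin hne)).exists
  have hx1 : 1 < x := hx1
  have hn : ‖(x : ℂ) * t‖ = x * ‖t‖ := by
    rw [norm_mul, Complex.norm_real, Real.norm_of_nonneg (zero_lt_one.trans hx1).le]
  refine ⟨x * t, hxU, ?_, fun h => hxw ?_⟩
  · rw [hn]
    exact one_lt_mul_of_lt_of_le hx1 ht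
  · rw [← h, hn, mul_div_cancel_right₀ _ ht0.ne']

theorem one_le_norm_one_add_div {q v : ℂ} (hv : v ≠ 0) (h : ‖v‖ ≤ ‖q + v‖) :
    1 ≤ ‖1 + q / v‖ := by
  rw [one_add_div hv, norm_div, one_le_div (norm_pos_iff.2 hv), add_comm]
  exact h

/-- Zeros in `q` at fixed `v₀ ≠ 0`. -/
theorem eventually_exists_dichromatic_eq_zero_left {q₀ v₀ : ℂ} (h : ‖v₀‖ ≤ ‖q₀ + v₀‖)
    (hv : v₀ ≠ 0) {ε : ℝ} (hε : 0 < ε) :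
    ∀ᶠ s : ℕ in atTop, ∀ᶠ p : ℕ in atTop,
      ∃ q : ℂ, ‖q - q₀‖ < ε ∧ (thetaGraph s p).dichromatic q v₀ = 0 := by
  set U : Set ℂ := {t | ‖(-v₀ + v₀ * t) - q₀‖ < ε} with hU
  have hUo : IsOpen U := isOpen_lt (by fun_prop) continuous_const
  have hmem : 1 + q₀ / v₀ ∈ U := by
    have : (-v₀ + v₀ * (1 + q₀ / v₀)) - q₀ = 0 := by field_simp; ring
    simpa [hU, this] using hε
  -- The excluded point corresponds to q = 1.
  obtain ⟨t₀, ht₀U, ht₀, hw⟩ := exists_mem_one_lt_norm_ne (one_le_norm_one_add_div hv h)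
    (hUo.mem_nhds hmem) (1 + 1 / v₀)
  have h0 : -v₀ + v₀ * t₀ ≠ 0 := fun h0 => by
    have : t₀ = 1 := mul_left_cancel₀ hv (by linear_combination h0)
    rw [this, norm_one] at ht₀
    exact lt_irrefl _ ht₀
  have h1 : -v₀ + v₀ * t₀ ≠ 1 := fun h1 => hw (by field_simp; linear_combination h1)
  filter_upwards [eventually_eventually_exists_root ht₀ h0 h1 (hUo.mem_nhds ht₀U),
    eventually_ge_atTop 1] with s hs hs1
  filter_upwards [hs] with p ⟨t, htU, htq, ht⟩
  exact ⟨_, htU, dichromatic_thetaGraph_eq_zero hs1 htq (by ring) ht⟩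

/-- Zeros in `v` at fixed `q₀ ≠ 1`. -/
theorem eventually_exists_dichromatic_eq_zero_right {q₀ v₀ : ℂ} (h : ‖v₀‖ ≤ ‖q₀ + v₀‖)
    (hq1 : q₀ ≠ 1) {ε : ℝ} (hε : 0 < ε) :
    ∀ᶠ s : ℕ in atTop, ∀ᶠ p : ℕ in atTop,
      ∃ v : ℂ, ‖v - v₀‖ < ε ∧ (thetaGraph s p).dichromatic q₀ v = 0 := by
  rcases eq_or_ne q₀ 0 with rfl | hq0
  · exact Eventually.of_forall fun s => Eventually.of_forall fun p =>
      ⟨v₀, by simpa using hε, dichromatic_zero_left_thetaGraph s p v₀⟩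
  -- At v₀ = 0 the variable t is undefined, so v₀ is replaced by a small positive multiple of q₀.
  obtain ⟨v₁, hv₁, hv₁ε, hle⟩ : ∃ v₁ : ℂ, v₁ ≠ 0 ∧ ‖v₁ - v₀‖ < ε ∧ ‖v₁‖ ≤ ‖q₀ + v₁‖ := by
    rcases eq_or_ne v₀ 0 with rfl | hv
    · have hq : 0 < ‖q₀‖ := norm_pos_iff.2 hq0
      obtain ⟨δ, hδ, hδ'⟩ := exists_between (div_pos hε hq)
      have hn : ‖(δ : ℂ)‖ = δ := by rw [Complex.norm_real, Real.norm_of_nonneg hδ.le]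
      have hn' : ‖(1 + δ : ℂ)‖ = 1 + δ := by
        rw [← Complex.ofReal_one, ← Complex.ofReal_add, Complex.norm_real,
          Real.norm_of_nonneg (by positivity)]
      refine ⟨δ * q₀, mul_ne_zero (by exact_mod_cast hδ.ne') hq0, ?_, ?_⟩
      · rw [sub_zero, norm_mul, hn]
        exact (lt_div_iff₀ hq).1 hδ'
      · rw [← one_add_mul, norm_mul, norm_mul, hn, hn']
        gcongr
        linarith
    · exact ⟨v₀, hv, by simpa using hε, h⟩
  have hU : {t : ℂ | t ≠ 1 ∧ ‖q₀ / (t - 1) - v₀‖ < ε} ∈ 𝓝 (1 + q₀ / v₁) := by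
    have hne : 1 + q₀ / v₁ ≠ 1 := by
      simpa using ⟨hq0, hv₁⟩
    have hc : ContinuousAt (fun t : ℂ => ‖q₀ / (t - 1) - v₀‖) (1 + q₀ / v₁) := by
      refine ((continuousAt_const.div (continuousAt_id.sub continuousAt_const) ?_).sub
        continuousAt_const).norm
      exact sub_ne_zero.2 hne
    have hval : q₀ / (1 + q₀ / v₁ - 1) - v₀ = v₁ - v₀ := by
      rw [add_sub_cancel_left]
      field_simp
    exact (eventually_ne_nhds hne).and (hc.eventually (gt_mem_nhds (by simpa only [hval] using hv₁ε)))
  -- The excluded point 0 is a dummy: q is constant here and already differs from 1.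
  obtain ⟨t₀, ht₀U, ht₀, -⟩ := exists_mem_one_lt_norm_ne (one_le_norm_one_add_div hv₁ hle)
    (interior_mem_nhds.2 hU) 0
  filter_upwards [eventually_eventually_exists_root (A := q₀) (B := 0) ht₀ (by simpa using hq0)
    (by simpa using hq1) (isOpen_interior.mem_nhds ht₀U), eventually_ge_atTop 1] with s hs hs1
  filter_upwards [hs] with p ⟨t, htU, _, ht⟩
  obtain ⟨ht1, htv⟩ := interior_subset htU
  rw [zero_mul, add_zero] at ht
  refine ⟨_, htv, dichromatic_thetaGraph_eq_zero hs1 hq0 ?_ ht⟩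
  have := sub_ne_zero.2 ht1
  field_simp
  ring

theorem theorem1p2 (q₀ v₀ : ℂ) (h : ‖v₀‖ ≤ ‖q₀ + v₀‖) (ε : ℝ) (hε : 0 < ε) :
    ∃ (s₀ : ℕ) (p₀ : ℕ → ℕ), ∀ s ≥ s₀, ∀ p ≥ p₀ s,
      (v₀ ≠ 0 → ∃ q : ℂ, ‖q - q₀‖ < ε ∧ (thetaGraph s p).dichromatic q v₀ = 0) ∧
      (q₀ ≠ 1 → ∃ v : ℂ, ‖v - v₀‖ < ε ∧ (thetaGraph s p).dichromatic q₀ v = 0) := by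
  have key : ∀ᶠ s : ℕ in atTop, ∀ᶠ p : ℕ in atTop,
      (v₀ ≠ 0 → ∃ q : ℂ, ‖q - q₀‖ < ε ∧ (thetaGraph s p).dichromatic q v₀ = 0) ∧
      (q₀ ≠ 1 → ∃ v : ℂ, ‖v - v₀‖ < ε ∧ (thetaGraph s p).dichromatic q₀ v = 0) := by
    have hl : ∀ᶠ s : ℕ in atTop, ∀ᶠ p : ℕ in atTop,
        v₀ ≠ 0 → ∃ q : ℂ, ‖q - q₀‖ < ε ∧ (thetaGraph s p).dichromatic q v₀ = 0 := by
      by_cases hv : v₀ = 0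
      · simp [hv]
      · simpa [hv] using eventually_exists_dichromatic_eq_zero_left h hv hε
    have hr : ∀ᶠ s : ℕ in atTop, ∀ᶠ p : ℕ in atTop,
        q₀ ≠ 1 → ∃ v : ℂ, ‖v - v₀‖ < ε ∧ (thetaGraph s p).dichromatic q₀ v = 0 := by
      by_cases hq : q₀ = 1
      · simp [hq]
      · simpa [hq] using eventually_exists_dichromatic_eq_zero_right h hq hε
    filter_upwards [hl, hr] with s hsl hsr using hsl.and hsr
  obtain ⟨s₀, hs₀⟩ := eventually_atTop.1 key
  choose! p₀ hp₀ using fun s hs => eventually_atTop.1 (hs₀ s hs)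
  exact ⟨s₀, p₀, hp₀⟩
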